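/- Let $\mathscr A$ be a Banach $^*$-algebra, that is, a complex (not necessarily unital) $^*$-algebra with a complete submultiplicative norm; the involution is not assumed to be continuous. Let $\mathscr M$ be a left ideal of $\mathscr A$ (a linear subspace with $xa\in\mathscr M$ for all $x\in\mathscr A$, $a\in\mathscr M$; not assumed closed), and let $f:\mathscr M\to\mathbb C$ be a linear functional. A linear functional $g:\mathscr A\to\mathbb C$ is called positive if $g(x^*x)\ge 0$ for all $x\in\mathscr A$; a positive functional $g$ is called representable if there are a Hilbert space $H$, a $^*$-representation $\pi$ of $\mathscr A$ by bounded operators on $H$, and a vector $\zeta\in H$ such that $g(x)=(\pi(x)\zeta\,|\,\zeta)$ for all $x\in\mathscr A$. Let $\mathscr A'$ denote the space of continuous linear functionals on $\mathscr A$. The following statements are equivalent: (i) There is a representable positive functional $f_N\in\mathscr A'$ extending $f$ which is minimal in the sense that $$f_N(x^*x)\le\widetilde f(x^*x)\qquad\text{for all }x\in\mathscr A$$ holds for every representable positive functional $\widetilde f\in\mathscr A'$ extending $f$. (ii) There is a representable positive functional $\widetilde f\in\mathscr A'$ extending $f$. (iii) There is a number $C\ge 0$ such that for all $a\in\mathscr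 M$ the number $C\cdot f(a^*a)$ is real and $$|f(a)|^2\le C\cdot f(a^*a).$$ -/

import Mathlib

open scoped ComplexOrder

universe u

/-- A left ideal of a (possibly non-unital) complex algebra: a linear subspace `M` such that
`x * a ∈ M` whenever `a ∈ M`. -/
def IsLeftIdeal {A : Type u} [NonUnitalNormedRing A] [NormedSpace ℂ A]
    (M : Submodule ℂ A) : Prop :=
  ∀ x : A, ∀ a ∈ M, x * a ∈ M

/-- A linear functional `g` on a `*`-algebra is positive if `g (x* x) ≥ 0` for all `x`
(in the order of `ℂ`: the value is real and nonnegative). -/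
def IsPositiveFunctional {A : Type u} [NonUnitalNormedRing A] [NormedSpace ℂ A] [Star A]
    (g : A →ₗ[ℂ] ℂ) : Prop :=
  ∀ x : A, 0 ≤ g (star x * x)

/-- A positive functional `g` is representable if there are a `*`-representation `π` of `A` by
bounded operators on a Hilbert space `H` and a vector `ζ` with `g x = (π(x)ζ | ζ)` for all `x`.
Mathlib's inner product is linear in the second variable, hence the order of the arguments.
No generality is lost by taking `H` in the universe of `A`, because one may restrict `π` to the
closed linear span of `π(A)ζ` and project `ζ` onto it. -/
def IsRepresentable {A : Type u} [NonUnitalNormedRing A] [NormedSpace ℂ A] [Star A]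
    (g : A →ₗ[ℂ] ℂ) : Prop :=
  IsPositiveFunctional g ∧
    ∃ (H : Type u) (_ : NormedAddCommGroup H) (_ : InnerProductSpace ℂ H) (_ : CompleteSpace H)
      (π : A →⋆ₙₐ[ℂ] (H →L[ℂ] H)) (ζ : H), ∀ x : A, g x = inner ℂ ζ (π x ζ)

/-- `g`, a continuous linear functional on `A`, is a representable positive extension of the
linear functional `f` on the subspace `M`. -/
def IsRepresentableExtension {A : Type u} [NonUnitalNormedRing A] [NormedSpace ℂ A] [Star A]
    {M : Submodule ℂ A} (f : M →ₗ[ℂ] ℂ) (g : A →L[ℂ] ℂ) : Prop :=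
  IsRepresentable (g : A →ₗ[ℂ] ℂ) ∧ ∀ a : M, g (a : A) = f a

/-! A bounded `f` on the ideal already determines a GNS construction. The form `⟨a, b⟩ = f (star a *
b)` is a semi-inner product on `M`, and left multiplication is a `*`-representation of `A` for it.
The bound in (iii) makes `f` continuous for this form, so Riesz gives a vector `ζ` in the completion
with `f a = ⟨ζ, a⟩`. Then `π a ζ` is the class of `a`, and `fN x = ⟨ζ, π x ζ⟩` extends `f`. It is
minimal because `‖π x ζ‖` is determined by pairing with the dense image of `M`, and any other
extension reproduces these pairings in its own Hilbert space. The converse bound is Cauchy–Schwarz.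

A possibly discontinuous involution causes two difficulties. The operators `π x` are bounded by
Ford's square root lemma, `exists_isSelfAdjoint_add_eq_add_mul_self`. The functional `fN` is
continuous by `exists_norm_map_le`, which applies the open mapping theorem to the closed graph of
the involution. -/

open Filter Topology

/-! ### Spectra via the ℓ¹ unitization -/

section Quasispectrum

variable {A : Type*} [NonUnitalNormedRing A] [NormedSpace ℂ A]
  [IsScalarTower ℂ A A] [SMulCommClass ℂ A A]

theorem quasispectrum_eq_spectrum_toLp_inr (x : A) :
    quasispectrum ℂ x = spectrum ℂ (WithLp.toLp 1 (x : Unitization ℂ A)) := by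
  rw [Unitization.quasispectrum_eq_spectrum_inr,
    ← AlgEquiv.spectrum_eq (WithLp.unitizationAlgEquiv ℂ).symm (x : Unitization ℂ A)]
  rfl

theorem norm_toLp_inr (x : A) : ‖WithLp.toLp 1 (x : Unitization ℂ A)‖ = ‖x‖ := by
  simp [WithLp.unitization_norm_def]

theorem norm_le_of_mem_quasispectrum [CompleteSpace A] {x : A} {k : ℂ}
    (hk : k ∈ quasispectrum ℂ x) : ‖k‖ ≤ ‖x‖ := by
  rw [quasispectrum_eq_spectrum_toLp_inr] at hk
  have h1 : ‖(1 : WithLp 1 (Unitization ℂ A))‖ = 1 := by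
    have : (1 : WithLp 1 (Unitization ℂ A)) = WithLp.toLp 1 (1 : Unitization ℂ A) := rfl
    simp [this, WithLp.unitization_norm_def]
  simpa [h1, norm_toLp_inr] using spectrum.norm_le_norm_mul_of_mem hk

theorem star_mem_quasispectrum_star [StarRing A] [StarModule ℂ A] {x : A} {k : ℂ}
    (hk : k ∈ quasispectrum ℂ (star x)) : star k ∈ quasispectrum ℂ x := by
  rw [Unitization.quasispectrum_eq_spectrum_inr] at hk ⊢
  rw [Unitization.inr_star, ← star_star k] at hk
  rw [spectrum.map_star, Set.star_mem_star] at hk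
  exact hk

end Quasispectrum

/-! ### A cancellation argument using the spectral radius -/

section UnitalBanach

variable {B : Type*} [NormedRing B] [NormedAlgebra ℂ B] [CompleteSpace B]

theorem exists_norm_pow_lt_one_of_spectralRadius_lt_one {y : B} (hy : spectralRadius ℂ y < 1) :
    ∃ n : ℕ, ‖y ^ n‖ < 1 := by
  have h := spectrum.pow_nnnorm_pow_one_div_tendsto_nhds_spectralRadius y
  obtain ⟨n, hn, hn0⟩ := ((h.eventually_lt_const hy).and (eventually_gt_atTop 0)).exists
  refine ⟨n, ?_⟩
  by_contra! hc
  refine absurd hn (not_lt.mpr (ENNReal.one_le_rpow ?_ (by positivity)))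
  exact_mod_cast hc

/-- If `x` has small norm, then `2 - x` is too large to agree with an element of spectral radius
less than one on a nonzero ideal. -/
theorem eq_zero_of_mul_add_eq_two_mul {d x y : B} (hx : ‖x‖ ≤ 1 / 2) (hdx : Commute d x)
    (hy : spectralRadius ℂ y < 1) (h : d * (x + y) = 2 * d) : d = 0 := by
  -- The relation `2dyⁿ = dyⁿ⁺¹ + xdyⁿ` and `‖x‖ ≤ 1/2` keep `‖dyⁿ‖` from decreasing, although some
  -- `‖yⁿ‖ < 1`.
  have step (n : ℕ) : ‖d‖ ≤ ‖d * y ^ n‖ := by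
    induction n with
    | zero => simp
    | succ n ih =>
      refine ih.trans ?_
      have e : 2 * (d * y ^ n) = d * y ^ (n + 1) + x * (d * y ^ n) := by
        rw [pow_succ', ← mul_assoc, ← h, ← mul_assoc, ← mul_assoc, ← hdx.eq]
        noncomm_ring
      have e2 : ‖(2 : ℝ) • (d * y ^ n)‖ ≤ ‖d * y ^ (n + 1)‖ + 1 / 2 * ‖d * y ^ n‖ := by
        rw [two_smul, ← two_mul, e]
        refine (norm_add_le _ _).trans (add_le_add_right ((norm_mul_le _ _).trans ?_) _)
        gcongr
      rw [norm_smul, Real.norm_ofNat] at e2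
      nlinarith [norm_nonneg (d * y ^ n)]
  obtain ⟨n, hn⟩ := exists_norm_pow_lt_one_of_spectralRadius_lt_one hy
  have := (step n).trans (norm_mul_le _ _)
  rw [← norm_eq_zero]
  nlinarith [norm_nonneg d]

end UnitalBanach

/-! ### Square roots in a Banach `*`-algebra -/

section SquareRoot

variable {A : Type*} [NonUnitalNormedRing A] [NormedSpace ℂ A]
  [IsScalarTower ℂ A A] [SMulCommClass ℂ A A] [CompleteSpace A]

/-- The square root `1 - x` of `1 - h`, obtained as the fixed point of `x ↦ (h + x * x) / 2`. -/
theorem exists_add_eq_add_mul_self {h : A} (hh : ‖h‖ ≤ 1 / 2) :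
    ∃ x : A, ‖x‖ ≤ 1 / 2 ∧ x + x = h + x * x ∧ ∀ y, Commute y h → Commute y x := by
  -- Commutation with the commutant of `h` is a closed condition preserved by the iteration, so the
  -- fixed point inherits it.
  let S : Set A := {x | ‖x‖ ≤ 1 / 2 ∧ ∀ y, Commute y h → Commute y x}
  have hS : IsClosed S := by
    have : S = {x | ‖x‖ ≤ 1 / 2} ∩ ⋂ y, ⋂ (_ : Commute y h), {x | y * x = x * y} := by
      ext x; simp [S, Commute, SemiconjBy]
    rw [this]
    refine (isClosed_le (by fun_prop) (by fun_prop)).inter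
      (isClosed_iInter fun y => isClosed_iInter fun _ => isClosed_eq (by fun_prop) (by fun_prop))
  have : CompleteSpace S := hS.completeSpace_coe
  have n2 : ‖(2⁻¹ : ℂ)‖ = 1 / 2 := by simp
  let T : S → S := fun x => ⟨(2⁻¹ : ℂ) • (h + x * x), by
    refine ⟨?_, fun y hy => ?_⟩
    · rw [norm_smul, n2]
      have := norm_add_le h ((x : A) * x)
      have := norm_mul_le (x : A) x
      have := x.2.1
      nlinarith [norm_nonneg (x : A)]
    · exact (hy.add_right ((x.2.2 y hy).mul_right (x.2.2 y hy))).smul_right _⟩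
  have : Nonempty S := ⟨⟨0, by simp, fun y _ => Commute.zero_right y⟩⟩
  have hT : ContractingWith (1 / 2) T := by
    refine ⟨by rw [← NNReal.coe_lt_coe]; norm_num, LipschitzWith.of_dist_le_mul fun x y => ?_⟩
    rw [Subtype.dist_eq, Subtype.dist_eq, dist_eq_norm, dist_eq_norm]
    have e : (T x : A) - T y = (2⁻¹ : ℂ) • ((x : A) * (x - y) + (x - y) * y) := by
      simp only [T, ← smul_sub]
      congr 1
      noncomm_ring
    rw [e, norm_smul, n2]
    have h1 := norm_add_le ((x : A) * (x - y)) ((x - y) * y)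
    have h2 := norm_mul_le (x : A) (x - y)
    have h3 := norm_mul_le (x - y : A) y
    have := x.2.1
    have := y.2.1
    have h4 := norm_nonneg (x - y : A)
    push_cast
    nlinarith
  have hfix : Function.IsFixedPt T hT.fixedPoint := hT.fixedPoint_isFixedPt
  refine ⟨hT.fixedPoint, hT.fixedPoint.2.1, ?_, hT.fixedPoint.2.2⟩
  have h1 : (2⁻¹ : ℂ) • (h + (hT.fixedPoint : A) * hT.fixedPoint) = hT.fixedPoint :=
    congrArg Subtype.val hfix
  rw [← two_smul ℂ (hT.fixedPoint : A)]
  nth_rw 1 [← h1]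
  simp

/-- **Ford's square root lemma**, for an involution that need not be continuous: the square root
of `1 - h` is self-adjoint when `h` is. -/
theorem exists_isSelfAdjoint_add_eq_add_mul_self [StarRing A] [StarModule ℂ A] {h : A}
    (hh : ‖h‖ ≤ 1 / 2) (hsa : IsSelfAdjoint h) :
    ∃ x : A, IsSelfAdjoint x ∧ x + x = h + x * x := by
  obtain ⟨x, hx, hxh, hcomm⟩ := exists_add_eq_add_mul_self hh
  refine ⟨x, ?_, hxh⟩
  have hy : star x + star x = h + star x * star x := by
    have := congrArg star hxh
    simpa [hsa.star_eq] using this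
  have hyh : Commute (star x) h := by
    have : h = star x + star x - star x * star x := by rw [hy]; abel
    rw [this]
    exact (((Commute.refl _).add_right (Commute.refl _)).sub_right
      ((Commute.refl _).mul_right (Commute.refl _)))
  have hyx : Commute (star x) x := hcomm _ hyh
  let ι : A → WithLp 1 (Unitization ℂ A) := fun a => WithLp.toLp 1 (a : Unitization ℂ A)
  have ι_mul (a b : A) : ι (a * b) = ι a * ι b := by
    simp only [ι, Unitization.inr_mul]; rfl
  have ι_add (a b : A) : ι (a + b) = ι a + ι b := by
    simp only [ι, Unitization.inr_add]; rfl
  -- Nothing bounds `‖star x‖`, but the spectrum of `star x` is conjugate to that of `x`, hence lies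
  -- in the disc of radius `1/2`.
  have hr : spectralRadius ℂ (ι (star x)) < 1 := by
    refine lt_of_le_of_lt (b := ((1 / 2 : NNReal) : ENNReal)) (iSup₂_le fun k hk => ?_) ?_
    · rw [← quasispectrum_eq_spectrum_toLp_inr] at hk
      have := (norm_le_of_mem_quasispectrum (star_mem_quasispectrum_star hk)).trans hx
      rw [norm_star] at this
      rw [ENNReal.coe_le_coe, ← NNReal.coe_le_coe]
      simpa using this
    · rw [← ENNReal.coe_one, ENNReal.coe_lt_coe, ← NNReal.coe_lt_coe]
      norm_num
  -- Subtracting the equations for `x` and `star x`, which commute, gives `(x - star x)(x + star x)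
  -- = 2(x - star x)`.
  have hd : ι (x - star x) = 0 := by
    refine eq_zero_of_mul_add_eq_two_mul (x := ι x) (y := ι (star x)) ?_ ?_ hr ?_
    · exact (norm_toLp_inr x).le.trans hx
    · have : Commute (x - star x) x := (Commute.refl x).sub_left hyx
      rw [Commute, SemiconjBy, ← ι_mul, ← ι_mul, this.eq]
    · rw [two_mul, ← ι_add, ← ι_add, ← ι_mul]
      congr 1
      have e1 : (x - star x) * (x + star x) = x * x - star x * star x := by
        rw [sub_mul, mul_add, mul_add, hyx.eq]; abel
      have e2 : x * x = x + x - h := by rw [hxh]; abel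
      have e3 : star x * star x = star x + star x - h := by rw [hy]; abel
      rw [e1, e2, e3]; abel
  have : ‖x - star x‖ = 0 := by
    rw [← norm_toLp_inr (x - star x)]
    exact norm_eq_zero.mpr hd
  exact (sub_eq_zero.mp (norm_eq_zero.mp this)).symm

end SquareRoot

/-! ### Representations on pre-Hilbert spaces -/

section PreHilbert

open UniformSpace

variable {A : Type*} [NonUnitalNormedRing A] [NormedSpace ℂ A]
  [IsScalarTower ℂ A A] [SMulCommClass ℂ A A] [CompleteSpace A] [StarRing A] [StarModule ℂ A]
  {E : Type*} [SeminormedAddCommGroup E] [InnerProductSpace ℂ E]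

/-- A `*`-representation of a Banach `*`-algebra on a pre-Hilbert space acts by bounded
operators. -/
theorem norm_apply_sq_le_of_inner_apply_eq (ρ : A →ₙₐ[ℂ] Module.End ℂ E)
    (hρ : ∀ x a b, inner ℂ (ρ x a) b = inner ℂ a (ρ (star x) b)) (x : A) (a : E) :
    ‖ρ x a‖ ^ 2 ≤ 2 * ‖star x * x‖ * ‖a‖ ^ 2 := by
  -- For `h = 2y - y²` with `y` self-adjoint, `‖a‖² - re ⟨a, ha⟩ = ‖a - ya‖²`.
  have key (h : A) (hh : ‖h‖ ≤ 1 / 2) (hsa : IsSelfAdjoint h) :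
      (inner ℂ a (ρ h a)).re ≤ ‖a‖ ^ 2 := by
    obtain ⟨y, hy, hyh⟩ := exists_isSelfAdjoint_add_eq_add_mul_self hh hsa
    have e : h = y + y - y * y := by rw [hyh]; abel
    have h0 : 0 ≤ ‖a - ρ y a‖ ^ 2 := by positivity
    have h1 : ‖ρ y a‖ ^ 2 = (inner ℂ a (ρ (y * y) a)).re := by
      rw [← inner_self_eq_norm_sq (𝕜 := ℂ), hρ, hy.star_eq, map_mul]; rfl
    rw [norm_sub_sq (𝕜 := ℂ), h1] at h0
    rw [e, map_sub, map_add]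
    simp only [LinearMap.sub_apply, LinearMap.add_apply, inner_sub_right, inner_add_right,
      Complex.sub_re, Complex.add_re]
    simp only [RCLike.re_to_complex] at h0
    linarith
  have hsq : ‖ρ x a‖ ^ 2 = (inner ℂ a (ρ (star x * x) a)).re := by
    rw [← inner_self_eq_norm_sq (𝕜 := ℂ), hρ, map_mul]; rfl
  have scaled (t : ℝ) (ht : |t| * ‖star x * x‖ ≤ 1 / 2) : t * ‖ρ x a‖ ^ 2 ≤ ‖a‖ ^ 2 := by
    have := key ((t : ℂ) • (star x * x)) (by simpa [norm_smul] using ht)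
      (IsSelfAdjoint.smul (Complex.conj_ofReal t) (.star_mul_self x))
    rw [map_smul, LinearMap.smul_apply, inner_smul_right, Complex.re_ofReal_mul, ← hsq] at this
    exact this
  -- If `‖star x * x‖ = 0`, every `t` is admissible, so `‖ρ x a‖ = 0`. Otherwise the largest
  -- admissible `t` yields the factor 2.
  rcases (norm_nonneg (star x * x)).eq_or_lt with h0 | hpos
  · rw [← h0]
    by_contra! hc
    simp only [mul_zero, zero_mul] at hc
    have := scaled ((‖a‖ ^ 2 + 1) / ‖ρ x a‖ ^ 2) (by simp [← h0])
    rw [div_mul_cancel₀ _ hc.ne'] at this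
    linarith
  · have := scaled ((2 * ‖star x * x‖)⁻¹) (by
      rw [abs_of_pos (by positivity)]
      field_simp
      norm_num)
    rwa [inv_mul_le_iff₀ (by positivity)] at this

/-- The bounded operator by which an element of a Banach `*`-algebra acts on a pre-Hilbert space. -/
noncomputable def boundedAction (ρ : A →ₙₐ[ℂ] Module.End ℂ E)
    (hρ : ∀ x a b, inner ℂ (ρ x a) b = inner ℂ a (ρ (star x) b)) (x : A) : E →L[ℂ] E :=
  (ρ x).mkContinuous √(2 * ‖star x * x‖) fun a => by
    refine le_of_sq_le_sq ?_ (by positivity)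
    rw [mul_pow, Real.sq_sqrt (by positivity)]
    exact norm_apply_sq_le_of_inner_apply_eq ρ hρ x a

theorem completion_boundedAction_coe (ρ : A →ₙₐ[ℂ] Module.End ℂ E)
    (hρ : ∀ x a b, inner ℂ (ρ x a) b = inner ℂ a (ρ (star x) b)) (x : A) (a : E) :
    (boundedAction ρ hρ x).completion (a : Completion E) = (ρ x a : E) :=
  (boundedAction ρ hρ x).completion_apply_coe a

theorem ContinuousLinearMap.completion_ext {S T : Completion E →L[ℂ] Completion E}
    (h : ∀ a : E, S a = T a) : S = T :=
  ContinuousLinearMap.ext fun a =>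
    Completion.induction_on a (isClosed_eq S.continuous T.continuous) h

/-- The extension of a `*`-representation on a pre-Hilbert space to the completion. -/
noncomputable def completionRepresentation (ρ : A →ₙₐ[ℂ] Module.End ℂ E)
    (hρ : ∀ x a b, inner ℂ (ρ x a) b = inner ℂ a (ρ (star x) b)) :
    A →⋆ₙₐ[ℂ] (Completion E →L[ℂ] Completion E) where
  toFun x := (boundedAction ρ hρ x).completion
  map_smul' r x := ContinuousLinearMap.completion_ext fun a => by
    rw [smul_apply, completion_boundedAction_coe,
      completion_boundedAction_coe, map_smul, LinearMap.smul_apply, Completion.coe_smul]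
    rfl
  map_zero' := ContinuousLinearMap.completion_ext fun a => by
    rw [completion_boundedAction_coe, map_zero]
    rfl
  map_add' x y := ContinuousLinearMap.completion_ext fun a => by
    rw [add_apply, completion_boundedAction_coe,
      completion_boundedAction_coe, completion_boundedAction_coe, map_add, LinearMap.add_apply,
      Completion.coe_add]
  map_mul' x y := ContinuousLinearMap.completion_ext fun a => by
    rw [mul_apply_eq_comp, completion_boundedAction_coe,
      completion_boundedAction_coe, completion_boundedAction_coe, map_mul, Module.End.mul_apply]
  map_star' x := by
    refine (ContinuousLinearMap.eq_adjoint_iff _ _).mpr fun a b => ?_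
    refine Completion.induction_on₂ a b ?_ fun a b => ?_
    · exact isClosed_eq (by fun_prop) (by fun_prop)
    · rw [completion_boundedAction_coe, completion_boundedAction_coe, Completion.inner_coe,
        Completion.inner_coe, hρ, star_star]

@[simp]
theorem completionRepresentation_apply_coe (ρ : A →ₙₐ[ℂ] Module.End ℂ E)
    (hρ : ∀ x a b, inner ℂ (ρ x a) b = inner ℂ a (ρ (star x) b)) (x : A) (a : E) :
    completionRepresentation ρ hρ x (a : Completion E) = (ρ x a : E) :=
  completion_boundedAction_coe ρ hρ x a

end PreHilbert

/-! ### Automatic continuity of `*`-homomorphisms -/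

section AutomaticContinuity

variable {A : Type*} [NonUnitalNormedRing A] [NormedSpace ℂ A]
  [IsScalarTower ℂ A A] [SMulCommClass ℂ A A] [CompleteSpace A]
  {B : Type*} [CStarAlgebra B]

/-- Homomorphisms shrink quasispectra, and a self-adjoint element of a C⋆-algebra has norm equal to
its spectral radius. -/
theorem norm_map_le_of_isSelfAdjoint (φ : A →ₙₐ[ℂ] B) {x : A} (hx : IsSelfAdjoint (φ x)) :
    ‖φ x‖ ≤ ‖x‖ := by
  have h : spectralRadius ℂ (φ x) ≤ ‖x‖₊ := iSup₂_le fun k hk => by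
    have := norm_le_of_mem_quasispectrum (NonUnitalAlgHom.quasispectrum_apply_subset φ x
      (spectrum_subset_quasispectrum ℂ _ hk))
    exact_mod_cast this
  rw [hx.spectralRadius_eq_nnnorm] at h
  exact_mod_cast h

variable [StarRing A]

/-- The C⋆-identity for `φ (y * x)`. Allowing `y ≠ star x` matters: `(x, y)` will come from the
closure of the graph of the involution, where `‖y‖` can be controlled. -/
theorem norm_map_sq_le (φ : A →⋆ₙₐ[ℂ] B) {x y : A} (h : φ y = star (φ x)) :
    ‖φ x‖ ^ 2 ≤ ‖y‖ * ‖x‖ := by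
  have e : φ (y * x) = star (φ x) * φ x := by rw [map_mul, h]
  have := norm_map_le_of_isSelfAdjoint (φ : A →ₙₐ[ℂ] B) (x := y * x)
    (by change IsSelfAdjoint (φ (y * x)); rw [e]; exact .star_mul_self _)
  change ‖φ (y * x)‖ ≤ _ at this
  rw [e, CStarRing.norm_star_mul_self, ← sq] at this
  exact this.trans (norm_mul_le _ _)

theorem tendsto_map_of_tendsto_star (φ : A →⋆ₙₐ[ℂ] B) {u : ℕ → A} {z : A}
    (hu : Tendsto u atTop (𝓝 0)) (hz : Tendsto (fun n => star (u n)) atTop (𝓝 z)) :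
    Tendsto (fun n => φ (u n)) atTop (𝓝 0) := by
  have h1 : Tendsto (fun n => ‖star (u n)‖ * ‖u n‖) atTop (𝓝 0) := by
    simpa using hz.norm.mul hu.norm
  have h2 : Tendsto (fun n => ‖φ (u n)‖ ^ 2) atTop (𝓝 0) :=
    squeeze_zero (fun n => by positivity) (fun n => norm_map_sq_le φ (map_star φ _)) h1
  rw [tendsto_zero_iff_norm_tendsto_zero]
  simpa using h2.sqrt

/-- The kernel of a `*`-homomorphism contains the separating space of the involution. -/
theorem map_eq_star_of_tendsto (φ : A →⋆ₙₐ[ℂ] B) {v : ℕ → A} {x y : A}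
    (hx : Tendsto v atTop (𝓝 x)) (hy : Tendsto (fun n => star (v n)) atTop (𝓝 y)) :
    φ y = star (φ x) := by
  have h1 : Tendsto (fun n => v n - x) atTop (𝓝 0) := by simpa using hx.sub_const x
  have h2 : Tendsto (fun n => star (v n) - y) atTop (𝓝 0) := by simpa using hy.sub_const y
  have t1 := tendsto_map_of_tendsto_star φ h1 (z := y - star x) (by
    simpa using hy.sub_const (star x))
  have t2 := tendsto_map_of_tendsto_star φ h2 (z := x - star y) (by
    simpa using hx.sub_const (star y))
  have t3 := t1.star.sub t2
  have e (n : ℕ) : star (φ (v n - x)) - φ (star (v n) - y) = φ y - star (φ x) := by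
    simp only [map_sub, star_sub, map_star]; abel
  simp only [e, star_zero, sub_zero] at t3
  exact sub_eq_zero.mp (tendsto_nhds_unique tendsto_const_nhds t3)

variable [StarModule ℂ A]

/-- A `*`-homomorphism from a Banach `*`-algebra to a C⋆-algebra is bounded, even when the
involution of the domain is discontinuous. -/
theorem exists_norm_map_le (φ : A →⋆ₙₐ[ℂ] B) : ∃ C : ℝ, ∀ x, ‖φ x‖ ≤ C * ‖x‖ := by
  let starGraph : A →ₗ[ℝ] A × A :=
    { toFun := fun x => (x, star x)
      map_add' := fun x y => by simp
      map_smul' := fun r x => by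
        simp only [RingHom.id_apply, Prod.smul_mk, Prod.mk.injEq, true_and]
        rw [← Complex.coe_smul, star_smul, ← Complex.coe_smul]
        simp }
  -- The first projection of the closed graph is onto, hence open: each `x` has a partner `y` with
  -- `‖y‖ ≤ C‖x‖` and `φ y = star (φ x)`.
  let G : Submodule ℝ (A × A) := (LinearMap.range starGraph).topologicalClosure
  have hG : IsClosed (G : Set (A × A)) := Submodule.isClosed_topologicalClosure _
  have : CompleteSpace G := hG.completeSpace_coe
  let p : G →L[ℝ] A := (ContinuousLinearMap.fst ℝ A A).comp G.subtypeL
  have hp : Function.Surjective p := fun x =>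
    ⟨⟨(x, star x), Submodule.le_topologicalClosure _ ⟨x, rfl⟩⟩, rfl⟩
  obtain ⟨C, hC, h⟩ := p.exists_preimage_norm_le hp
  refine ⟨√C, fun x => ?_⟩
  obtain ⟨w, rfl, hw⟩ := h x
  have hwG : (w : A × A) ∈ closure (Set.range starGraph) := w.2
  obtain ⟨s, hs, hlim⟩ := mem_closure_iff_seq_limit.mp hwG
  choose v hv using hs
  obtain rfl : (fun n => starGraph (v n)) = s := funext hv
  have hstar : φ (w : A × A).2 = star (φ (p w)) :=
    map_eq_star_of_tendsto φ (v := v) ((continuous_fst.tendsto _).comp hlim)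
      ((continuous_snd.tendsto _).comp hlim)
  refine le_of_sq_le_sq ?_ (by positivity)
  rw [mul_pow, Real.sq_sqrt hC.le, sq ‖p w‖, ← mul_assoc]
  refine (norm_map_sq_le φ hstar).trans ?_
  gcongr
  exact (norm_snd_le (w : A × A)).trans hw

end AutomaticContinuity

/-! ### The GNS construction on a left ideal -/

namespace IsLeftIdeal

open UniformSpace

variable {A : Type u} [NonUnitalNormedRing A] [NormedSpace ℂ A]
  {M : Submodule ℂ A}

/-- The product `x * a` of an element of the algebra and an element of a left ideal. -/
def act (hM : IsLeftIdeal M) (x : A) (a : M) : M := ⟨x * a, hM x a a.2⟩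

variable [IsScalarTower ℂ A A] [SMulCommClass ℂ A A]

/-- Left multiplication on a left ideal. -/
def leftMul (hM : IsLeftIdeal M) : A →ₙₐ[ℂ] Module.End ℂ M where
  toFun x :=
    { toFun := hM.act x
      map_add' := fun a b => Subtype.ext (mul_add x (a : A) b)
      map_smul' := fun r a => Subtype.ext (mul_smul_comm r x (a : A)) }
  map_smul' r x := LinearMap.ext fun a => Subtype.ext (smul_mul_assoc r x (a : A))
  map_zero' := LinearMap.ext fun a => Subtype.ext (zero_mul (a : A))
  map_add' x y := LinearMap.ext fun a => Subtype.ext (add_mul x y (a : A))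
  map_mul' x y := LinearMap.ext fun a => Subtype.ext (mul_assoc x y (a : A))

@[simp]
theorem coe_leftMul (hM : IsLeftIdeal M) (x : A) (a : M) :
    (hM.leftMul x a : A) = x * a := rfl

variable [StarRing A]

/-- A left ideal with the semi-inner product `⟨a, b⟩ = f (star a * b)` defined by a positive
functional. -/
def PreGNS (hM : IsLeftIdeal M) (f : M →ₗ[ℂ] ℂ)
    (_ : ∀ a : M, 0 ≤ f (hM.leftMul (star (a : A)) a)) : Type u := M

variable (hM : IsLeftIdeal M) (f : M →ₗ[ℂ] ℂ)
  (hf : ∀ a : M, 0 ≤ f (hM.leftMul (star (a : A)) a))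

instance : AddCommGroup (hM.PreGNS f hf) := inferInstanceAs (AddCommGroup M)
instance : Module ℂ (hM.PreGNS f hf) := inferInstanceAs (Module ℂ M)

/-- The identification of a left ideal with its semi-inner product space. -/
def toPreGNS : M ≃ₗ[ℂ] hM.PreGNS f hf := LinearEquiv.refl ℂ _

/-- Left multiplication as an action on the semi-inner product space. -/
def preGNSAction : A →ₙₐ[ℂ] Module.End ℂ (hM.PreGNS f hf) := hM.leftMul

theorem preGNSAction_toPreGNS (x : A) (a : M) :
    hM.preGNSAction f hf x (toPreGNS hM f hf a) = toPreGNS hM f hf (hM.leftMul x a) := rfl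

variable [StarModule ℂ A]

/-- A functional that is positive on a left ideal induces a Hermitian form there. -/
theorem conj_apply_leftMul_star
    (hf : ∀ a : M, 0 ≤ f (hM.leftMul (star (a : A)) a)) (a b : M) :
    starRingEnd ℂ (f (hM.leftMul (star (b : A)) a)) = f (hM.leftMul (star (a : A)) b) := by
  have expand (r : ℂ) : f (hM.leftMul (star ((a + r • b : M) : A)) (a + r • b)) =
      f (hM.leftMul (star (a : A)) a) + r * f (hM.leftMul (star (a : A)) b) +
      (starRingEnd ℂ r * f (hM.leftMul (star (b : A)) a) +
        starRingEnd ℂ r * r * f (hM.leftMul (star (b : A)) b)) := by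
    simp [mul_assoc]
  have im (c : M) : (f (hM.leftMul (star (c : A)) c)).im = 0 :=
    (Complex.nonneg_iff.mp (hf c)).2.symm
  -- Polarization: `a + b` compares the imaginary parts, `a + ib` the real parts.
  have h1 := im (a + (1 : ℂ) • b)
  have hI := im (a + Complex.I • b)
  rw [expand] at h1 hI
  have ha := im a
  have hb := im b
  simp [ha, hb] at h1 hI
  apply Complex.ext
  · simp; linarith
  · simp; linarith

/-- The semi-inner product `⟨a, b⟩ = f (star a * b)`. -/
noncomputable abbrev preGNSCore : PreInnerProductSpace.Core ℂ (hM.PreGNS f hf) where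
  inner a b := f (hM.leftMul (star ((toPreGNS hM f hf).symm a : A)) ((toPreGNS hM f hf).symm b))
  conj_inner_symm a b := hM.conj_apply_leftMul_star f hf _ _
  re_inner_nonneg a := (Complex.nonneg_iff.mp (hf ((toPreGNS hM f hf).symm a))).1
  add_left a b c := by simp
  smul_left a b r := by simp

noncomputable instance : SeminormedAddCommGroup (hM.PreGNS f hf) :=
  InnerProductSpace.Core.toSeminormedAddCommGroup (c := hM.preGNSCore f hf)

noncomputable instance : InnerProductSpace ℂ (hM.PreGNS f hf) :=
  InnerProductSpace.ofCore (hM.preGNSCore f hf)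

theorem inner_toPreGNS (a b : M) :
    inner ℂ (toPreGNS hM f hf a) (toPreGNS hM f hf b) = f (hM.leftMul (star (a : A)) b) := rfl

theorem norm_toPreGNS_sq (a : M) :
    ‖toPreGNS hM f hf a‖ ^ 2 = (f (hM.leftMul (star (a : A)) a)).re :=
  (inner_self_eq_norm_sq (𝕜 := ℂ) _).symm

theorem inner_preGNSAction (x : A) (a b : hM.PreGNS f hf) :
    inner ℂ (hM.preGNSAction f hf x a) b = inner ℂ a (hM.preGNSAction f hf (star x) b) := by
  obtain ⟨a, rfl⟩ := (toPreGNS hM f hf).surjective a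
  obtain ⟨b, rfl⟩ := (toPreGNS hM f hf).surjective b
  rw [preGNSAction_toPreGNS, preGNSAction_toPreGNS, inner_toPreGNS, inner_toPreGNS]
  congr 1
  ext
  simp

/-- A functional bounded for the semi-inner product is given by a vector of the completion. -/
theorem exists_inner_toPreGNS_eq {C : ℝ}
    (hC : ∀ a : M, ‖f a‖ ^ 2 ≤ C * (f (hM.leftMul (star (a : A)) a)).re) :
    ∃ ζ : Completion (hM.PreGNS f hf), ∀ a : M,
      inner ℂ ζ (toPreGNS hM f hf a : hM.PreGNS f hf) = f a := by
  let F : hM.PreGNS f hf →L[ℂ] ℂ :=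
    LinearMap.mkContinuous (f ∘ₗ (toPreGNS hM f hf).symm.toLinearMap) √|C| fun a => by
      refine le_of_sq_le_sq ?_ (by positivity)
      rw [mul_pow, Real.sq_sqrt (by positivity), ← inner_self_eq_norm_sq (𝕜 := ℂ) a]
      refine (hC ((toPreGNS hM f hf).symm a)).trans ?_
      exact mul_le_mul_of_nonneg_right (le_abs_self C) (Complex.nonneg_iff.mp (hf _)).1
  let F' : Completion (hM.PreGNS f hf) →L[ℂ] ℂ := F.extend Completion.toComplL
  refine ⟨(InnerProductSpace.toDual ℂ _).symm F', fun a => ?_⟩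
  rw [InnerProductSpace.toDual_symm_apply]
  exact F.extend_eq (Completion.denseRange_coe) (Completion.isUniformInducing_coe _) _

variable [CompleteSpace A]

/-- The representation of a Banach `*`-algebra defined by a positive functional on a left ideal,
on the completion of that ideal. -/
noncomputable def gnsRepresentation :
    A →⋆ₙₐ[ℂ] (Completion (hM.PreGNS f hf) →L[ℂ] Completion (hM.PreGNS f hf)) :=
  completionRepresentation (hM.preGNSAction f hf) (hM.inner_preGNSAction f hf)

theorem gnsRepresentation_coe (x : A) (a : M) :
    hM.gnsRepresentation f hf x (toPreGNS hM f hf a : hM.PreGNS f hf) =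
      (toPreGNS hM f hf (hM.leftMul x a) : hM.PreGNS f hf) :=
  completionRepresentation_apply_coe _ _ _ _

/-- The representing vector is cyclic in a strong sense: an element `a` of the ideal maps it to
the class of `a`. -/
theorem gnsRepresentation_apply_eq {ζ : Completion (hM.PreGNS f hf)}
    (hζ : ∀ a : M, inner ℂ ζ (toPreGNS hM f hf a : hM.PreGNS f hf) = f a) (a : M) :
    hM.gnsRepresentation f hf (a : A) ζ = (toPreGNS hM f hf a : hM.PreGNS f hf) := by
  -- Testing on the dense ideal: `⟨b, π a ζ⟩ = ⟨star a * b, ζ⟩ = conj (f (star a * b)) = f (star b *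
  -- a) = ⟨b, a⟩`.
  refine ext_inner_left ℂ fun b => Completion.induction_on b
    (isClosed_eq (by fun_prop) (by fun_prop)) fun b => ?_
  obtain ⟨b, rfl⟩ := (toPreGNS hM f hf).surjective b
  rw [← ContinuousLinearMap.adjoint_inner_left, ← ContinuousLinearMap.star_eq_adjoint, ← map_star,
    gnsRepresentation_coe, Completion.inner_coe, ← inner_conj_symm, hζ,
    hM.conj_apply_leftMul_star f hf, inner_toPreGNS]

end IsLeftIdeal

/-! ### Vector functionals and the minimal extension -/

theorem inner_map_star_mul {A H : Type*} [NonUnitalNormedRing A] [NormedSpace ℂ A] [StarRing A]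
    [NormedAddCommGroup H] [InnerProductSpace ℂ H] [CompleteSpace H]
    (π : A →⋆ₙₐ[ℂ] (H →L[ℂ] H)) (ζ : H) (x y : A) :
    inner ℂ ζ (π (star x * y) ζ) = inner ℂ (π x ζ) (π y ζ) := by
  rw [map_mul, mul_apply_eq_comp, map_star, ContinuousLinearMap.star_eq_adjoint,
    ContinuousLinearMap.adjoint_inner_right]

theorem inner_map_star_mul_self {A H : Type*} [NonUnitalNormedRing A] [NormedSpace ℂ A]
    [StarRing A] [NormedAddCommGroup H] [InnerProductSpace ℂ H] [CompleteSpace H]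
    (π : A →⋆ₙₐ[ℂ] (H →L[ℂ] H)) (ζ : H) (x : A) :
    inner ℂ ζ (π (star x * x) ζ) = ((‖π x ζ‖ ^ 2 : ℝ) : ℂ) := by
  rw [inner_map_star_mul, inner_self_eq_norm_sq_to_K]
  simp

theorem isRepresentable_inner_map {A : Type u} [NonUnitalNormedRing A] [NormedSpace ℂ A]
    [StarRing A] {H : Type u} [NormedAddCommGroup H] [InnerProductSpace ℂ H] [CompleteSpace H]
    (π : A →⋆ₙₐ[ℂ] (H →L[ℂ] H)) (ζ : H) {g : A →ₗ[ℂ] ℂ}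
    (hg : ∀ x, g x = inner ℂ ζ (π x ζ)) : IsRepresentable g := by
  refine ⟨fun x => ?_, H, inferInstance, inferInstance, inferInstance, π, ζ, hg⟩
  rw [hg, inner_map_star_mul_self]
  exact Complex.zero_le_real.mpr (sq_nonneg _)

theorem exists_continuousLinearMap_eq_inner_map {A H : Type*} [NonUnitalNormedRing A] [NormedSpace ℂ A]
    [IsScalarTower ℂ A A] [SMulCommClass ℂ A A] [CompleteSpace A] [StarRing A] [StarModule ℂ A]
    [NormedAddCommGroup H] [InnerProductSpace ℂ H] [CompleteSpace H]
    (π : A →⋆ₙₐ[ℂ] (H →L[ℂ] H)) (ζ : H) :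
    ∃ g : A →L[ℂ] ℂ, ∀ x, g x = inner ℂ ζ (π x ζ) := by
  obtain ⟨C, hC⟩ := exists_norm_map_le π
  refine ⟨LinearMap.mkContinuous
    { toFun := fun x => inner ℂ ζ (π x ζ)
      map_add' := fun x y => by simp
      map_smul' := fun r x => by simp } (‖ζ‖ * ‖ζ‖ * C) fun x => ?_,
    fun x => rfl⟩
  calc ‖inner ℂ ζ (π x ζ)‖ ≤ ‖ζ‖ * ‖π x ζ‖ := norm_inner_le_norm _ _
    _ ≤ ‖ζ‖ * (C * ‖x‖ * ‖ζ‖) := by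
      gcongr
      exact ((π x).le_opNorm ζ).trans (by gcongr; exact hC x)
    _ = _ := by ring

/-- A representable extension restricts to a functional satisfying a Cauchy–Schwarz bound. -/
theorem IsRepresentableExtension.exists_bound {A : Type u} [NonUnitalNormedRing A]
    [NormedSpace ℂ A] [StarRing A] {M : Submodule ℂ A} (hM : IsLeftIdeal M) {f : M →ₗ[ℂ] ℂ}
    {g : A →L[ℂ] ℂ} (hg : IsRepresentableExtension f g) :
    ∃ C : ℝ, 0 ≤ C ∧ ∀ a : M,
      ((‖f a‖ ^ 2 : ℝ) : ℂ) ≤ (C : ℂ) * f ⟨star (a : A) * a, hM _ _ a.2⟩ := by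
  obtain ⟨⟨-, H, _, _, _, π, ζ, hπ⟩, hgf⟩ := hg
  simp only [ContinuousLinearMap.coe_coe] at hπ
  refine ⟨‖ζ‖ ^ 2, by positivity, fun a => ?_⟩
  rw [← hgf, ← hgf, hπ, hπ, inner_map_star_mul_self]
  norm_cast
  calc _ ≤ (‖ζ‖ * ‖π a ζ‖) ^ 2 := by
        gcongr
        exact norm_inner_le_norm _ _
    _ = _ := mul_pow _ _ _

theorem nonneg_of_ofReal_norm_sq_le {z w : ℂ} {C : ℝ} (hC : 0 < C)
    (h : ((‖z‖ ^ 2 : ℝ) : ℂ) ≤ C * w) : 0 ≤ w := by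
  have h0 : (0 : ℂ) ≤ C * w := le_trans (Complex.zero_le_real.mpr (sq_nonneg _)) h
  rw [Complex.nonneg_iff] at h0 ⊢
  simp only [Complex.re_ofReal_mul, Complex.im_ofReal_mul] at h0
  refine ⟨nonneg_of_mul_nonneg_right h0.1 hC, ?_⟩
  rcases mul_eq_zero.mp h0.2.symm with h | h
  · exact absurd h hC.ne'
  · exact h.symm

theorem exists_minimal_isRepresentableExtension {A : Type u} [NonUnitalNormedRing A]
    [NormedSpace ℂ A] [IsScalarTower ℂ A A] [SMulCommClass ℂ A A] [CompleteSpace A] [StarRing A]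
    [StarModule ℂ A] {M : Submodule ℂ A} (hM : IsLeftIdeal M) {f : M →ₗ[ℂ] ℂ} {C : ℝ}
    (hf : ∀ a : M, 0 ≤ f (hM.leftMul (star (a : A)) a))
    (hC : ∀ a : M, ‖f a‖ ^ 2 ≤ C * (f (hM.leftMul (star (a : A)) a)).re) :
    ∃ fN : A →L[ℂ] ℂ, IsRepresentableExtension f fN ∧
      ∀ g : A →L[ℂ] ℂ, IsRepresentableExtension f g →
        ∀ x : A, fN (star x * x) ≤ g (star x * x) := by
  obtain ⟨ζ, hζ⟩ := hM.exists_inner_toPreGNS_eq f hf hC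
  obtain ⟨fN, hfN⟩ := exists_continuousLinearMap_eq_inner_map (hM.gnsRepresentation f hf) ζ
  refine ⟨fN, ⟨isRepresentable_inner_map _ ζ hfN, fun a => ?_⟩, ?_⟩
  · rw [hfN, hM.gnsRepresentation_apply_eq f hf hζ, hζ]
  rintro g ⟨⟨-, H, _, _, _, π, ξ, hπ⟩, hgf⟩ x
  simp only [ContinuousLinearMap.coe_coe] at hπ
  rw [hfN, hπ, inner_map_star_mul_self, inner_map_star_mul_self]
  norm_cast
  gcongr
  set η := hM.gnsRepresentation f hf x ζ with hη
  -- For `b` in the ideal, `⟨b, η⟩ = ⟨π b ξ, π x ξ⟩` and `‖π b ξ‖ = ‖b‖`, as both reduce to values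
  -- of `f`, where `g` agrees. By density `b = η` is allowed, giving `‖η‖ ≤ ‖π x ξ‖`.
  have bound (b : UniformSpace.Completion (hM.PreGNS f hf)) :
      ‖inner ℂ b η‖ ≤ ‖b‖ * ‖π x ξ‖ := by
    refine UniformSpace.Completion.induction_on b (isClosed_le (by fun_prop) (by fun_prop)) ?_
    intro b
    obtain ⟨b, rfl⟩ := (IsLeftIdeal.toPreGNS hM f hf).surjective b
    have h1 : inner ℂ ((IsLeftIdeal.toPreGNS hM f hf b : hM.PreGNS f hf) :
        UniformSpace.Completion (hM.PreGNS f hf)) η = inner ℂ (π b ξ) (π x ξ) := by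
      rw [hη, ← ContinuousLinearMap.adjoint_inner_left, ← ContinuousLinearMap.star_eq_adjoint,
        ← map_star, IsLeftIdeal.gnsRepresentation_coe, ← inner_conj_symm, hζ, ← hgf, hπ,
        IsLeftIdeal.coe_leftMul, inner_map_star_mul, inner_conj_symm]
    have h2 : ‖π b ξ‖ = ‖IsLeftIdeal.toPreGNS hM f hf b‖ := by
      rw [← sq_eq_sq₀ (norm_nonneg _) (norm_nonneg _), IsLeftIdeal.norm_toPreGNS_sq, ← hgf, hπ,
        IsLeftIdeal.coe_leftMul, inner_map_star_mul_self, Complex.ofReal_re]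
    rw [h1, UniformSpace.Completion.norm_coe, ← h2]
    exact norm_inner_le_norm _ _
  have hself := bound η
  rw [inner_self_eq_norm_sq_to_K] at hself
  simp only [norm_pow] at hself
  rcases (norm_nonneg η).eq_or_lt with h0 | hpos
  · rw [← h0]; positivity
  · refine le_of_mul_le_mul_left ?_ hpos
    simpa [sq] using hself

theorem theorem5p5 {A : Type u} [NonUnitalNormedRing A] [NormedSpace ℂ A]
    [IsScalarTower ℂ A A] [SMulCommClass ℂ A A] [CompleteSpace A] [StarRing A] [StarModule ℂ A]
    (M : Submodule ℂ A) (hM : IsLeftIdeal M) (f : M →ₗ[ℂ] ℂ) :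
    List.TFAE [
      ∃ fN : A →L[ℂ] ℂ, IsRepresentableExtension f fN ∧
        ∀ g : A →L[ℂ] ℂ, IsRepresentableExtension f g →
          ∀ x : A, fN (star x * x) ≤ g (star x * x),
      ∃ g : A →L[ℂ] ℂ, IsRepresentableExtension f g,
      ∃ C : ℝ, 0 ≤ C ∧ ∀ a : M,
        ((‖f a‖ ^ 2 : ℝ) : ℂ) ≤ (C : ℂ) * f ⟨star (a : A) * a, hM _ _ a.2⟩] := by
  tfae_have 1 → 2 := fun ⟨fN, h, _⟩ => ⟨fN, h⟩
  tfae_have 2 → 3 := fun ⟨_, hg⟩ => hg.exists_bound hM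
  tfae_have 3 → 1 := by
    rintro ⟨C, hC0, hC⟩
    refine exists_minimal_isRepresentableExtension hM (C := C) (fun a => ?_) (fun a => ?_)
    · rcases hC0.eq_or_lt with rfl | hpos
      · have h := hC (hM.leftMul (star (a : A)) a)
        rw [Complex.ofReal_zero, zero_mul, ← Complex.ofReal_zero, Complex.real_le_real] at h
        have : f (hM.leftMul (star (a : A)) a) = 0 := by simpa using h.antisymm (sq_nonneg _)
        rw [this]
      · exact nonneg_of_ofReal_norm_sq_le hpos (hC a)
    · have := (Complex.le_def.mp (hC a)).1
      rwa [Complex.ofReal_re, Complex.re_ofReal_mul] at this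
  tfae_finish
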